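/- Conventions. For a countable relational language $L$, $\mathrm{Mod}(L)$ is the set of $L$-structures with universe $\omega$, identified through atomic diagrams with a Cantor space $2^{\{R(\bar a)\}}$, where $R(\bar a)$ ranges over the atomic sentences with $R$ a symbol of $L$ and $\bar a$ a tuple of natural numbers; it carries the Borel $\sigma$-algebra, and subsets carry the induced one. Let $\operatorname{TFAb}_1$ be the class of torsion-free abelian groups of rank $1$ with universe $\omega$ (in the language whose one symbol is a ternary relation for the graph of $+$), and for $r\in\omega$ let $\operatorname{FD}_r$ be the class of fields of characteristic $0$ and transcendence degree $r$ over $\mathbb{Q}$ with universe $\omega$ (in the language with ternary relations for the graphs of $+$ and $\cdot$). An equivalence relation $E$ on $X$ is Borel reducible to an equivalence relation $F$ on $Y$ if there is a Borel map $\Phi:X\to Y$ with $x\mathrel{E}y\iff\Phi(x)\mathrel{F}\Phi(y)$ for all $x,y\in X$; $E$ is smooth if it is Borel reducible to equality on $2^\omega$. A Borel embedding of a class $K$ in a class $K'$, written $K\leq_B K'$, is a Borel reduction of isomorphism on $K$ to isomorphism on $K'$. Finally, $E_0$ is the equivalence relation on $2^\omega$ given by $f\mathrel{E_0}g$ iff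 $f(n)=g(n)$ for all but finitely many $n$. Proposition. There is no Borel embedding of $\operatorname{FD}_1$ in $\operatorname{FD}_0$; that is, $\operatorname{FD}_1\not\leq_B\operatorname{FD}_0$. Moreover: (a) Isomorphism on $\operatorname{FD}_0$ is smooth, via existential theories. The map that takes $\mathcal{A}\in\operatorname{FD}_0$ to the set of existential first-order sentences true in $\mathcal{A}$ is Borel, and for $\mathcal{A},\mathcal{B}\in\operatorname{FD}_0$ we have $\mathcal{A}\cong\mathcal{B}$ if and only if $\mathcal{A}$ and $\mathcal{B}$ satisfy the same existential sentences. In fact the sentences $(\exists x)\,p(x)=0$ suffice: the map $\mathcal{A}\mapsto\{p\in\mathbb{Z}[X]:\mathcal{A}\models(\exists x)\,p(x)=0\}$ is Borel on $\operatorname{FD}_0$, and $\mathcal{A}\cong\mathcal{B}$ if and only if $\mathcal{A}$ and $\mathcal{B}$ have the same image. (b) $E_0$ is Borel reducible to isomorphism on $\operatorname{TFAb}_1$, and also to isomorphism on $\operatorname{FD}_1$. (c) $E_0$ is not smooth. -/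

import Mathlib

namespace FieldClasses

/-! ### The space of structures with universe `ℕ`, and reductions -/

/-- The atomic sentences `R(a₁, …, aₙ)` of a relational language `L`, with `aᵢ` natural numbers. -/
abbrev AtomicSentence (L : FirstOrder.Language.{0, 0}) : Type :=
  Σ n : ℕ, L.Relations n × (Fin n → ℕ)

/-- `Mod(L)`: the `L`-structures with universe `ℕ`, identified (through the atomic diagram) with
the elements of `2^(atomic sentences)`. It carries the product `σ`-algebra; for countable `L` this
is the Borel `σ`-algebra of the product topology. -/
abbrev Mod (L : FirstOrder.Language.{0, 0}) : Type :=
  AtomicSentence L → Bool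

/-- The first-order structure on `ℕ` that an atomic diagram describes. -/
@[reducible]
def Mod.toStructure {L : FirstOrder.Language.{0, 0}} [L.IsRelational] (A : Mod L) : L.Structure ℕ where
  funMap f := isEmptyElim f
  RelMap {n} R a := A ⟨n, R, a⟩ = true

/-- `A ≅ B` as `L`-structures. -/
def Mod.Iso {L : FirstOrder.Language.{0, 0}} [L.IsRelational] (A B : Mod L) : Prop :=
  Nonempty (@FirstOrder.Language.Equiv L ℕ ℕ A.toStructure B.toStructure)

/-- The isomorphism relation on a class `K ⊆ Mod(L)`. -/
def isoOn {L : FirstOrder.Language.{0, 0}} [L.IsRelational] (K : Set (Mod L)) (A B : K) : Prop :=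
  Mod.Iso (A : Mod L) (B : Mod L)

/-- Borel reducibility of the relation `E` on `X` to the relation `F` on `Y`. -/
def BorelReducible {X Y : Type} [MeasurableSpace X] [MeasurableSpace Y]
    (E : X → X → Prop) (F : Y → Y → Prop) : Prop :=
  ∃ Φ : X → Y, Measurable Φ ∧ ∀ x y : X, E x y ↔ F (Φ x) (Φ y)

/-- `K ≤_B K'`: there is a Borel function `Φ : K → K'` with `A ≅ B ↔ Φ(A) ≅ Φ(B)`. The classes
`K`, `K'` carry the `σ`-algebras induced from `Mod(L)`, `Mod(L')`. -/
def BorelEmbeddable {L L' : FirstOrder.Language.{0, 0}} [L.IsRelational] [L'.IsRelational]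
    (K : Set (Mod L)) (K' : Set (Mod L')) : Prop :=
  BorelReducible (isoOn K) (isoOn K')

/-- A relation is smooth if it is Borel reducible to equality on `2^ω`. -/
def Smooth {X : Type} [MeasurableSpace X] (E : X → X → Prop) : Prop :=
  BorelReducible E (fun s t : ℕ → Bool => s = t)

/-- The Vitali equivalence relation `E₀` on `2^ω`: equality at all but finitely many places. -/
def E0 (f g : ℕ → Bool) : Prop :=
  ∀ᶠ n in Filter.atTop, f n = g n

/-! ### Torsion-free abelian groups of rank `r` -/

/-- The only symbol of the language of groups: a ternary relation for the graph of `+`. -/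
inductive GroupRel : ℕ → Type
  | add : GroupRel 3

/-- The relational language of (abelian) groups. -/
abbrev groupLang : FirstOrder.Language.{0, 0} := ⟨fun _ => Empty, GroupRel⟩

instance : groupLang.IsRelational := fun _ => inferInstanceAs (IsEmpty Empty)

/-- `A` is the copy on `ℕ` of the group `G`, the number `n` standing for the element `e n`. -/
def IsGroupCopy (A : Mod groupLang) (G : Type) [AddCommGroup G] (e : ℕ ≃ G) : Prop :=
  ∀ a b c : ℕ, A ⟨3, GroupRel.add, ![a, b, c]⟩ = true ↔ e a + e b = e c

/-- `TFAb_r`: the structures with universe `ℕ` that are torsion-free abelian groups of rank `r`. -/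
def TFAb (r : ℕ) : Set (Mod groupLang) :=
  {A | ∃ (G : Type) (_ : AddCommGroup G) (e : ℕ ≃ G),
    IsGroupCopy A G e ∧ IsAddTorsionFree G ∧ Module.rank ℤ G = r}

/-! ### Fields of characteristic `0` and transcendence degree `r` -/

/-- The symbols of the language of fields: ternary relations for the graphs of `+` and `·`. -/
inductive FieldRel : ℕ → Type
  | add : FieldRel 3
  | mul : FieldRel 3

/-- The relational language of fields. -/
abbrev fieldLang : FirstOrder.Language.{0, 0} := ⟨fun _ => Empty, FieldRel⟩

instance : fieldLang.IsRelational := fun _ => inferInstanceAs (IsEmpty Empty)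

/-- `A` is the copy on `ℕ` of the field `F`, the number `n` standing for the element `e n`. -/
def IsFieldCopy (A : Mod fieldLang) (F : Type) [Field F] (e : ℕ ≃ F) : Prop :=
  (∀ a b c : ℕ, A ⟨3, FieldRel.add, ![a, b, c]⟩ = true ↔ e a + e b = e c) ∧
  (∀ a b c : ℕ, A ⟨3, FieldRel.mul, ![a, b, c]⟩ = true ↔ e a * e b = e c)

/-- `FD_r`: the structures with universe `ℕ` that are fields of characteristic `0` and of
transcendence degree `r` over `ℚ`. -/
def FD (r : ℕ) : Set (Mod fieldLang) :=
  {A | ∃ (F : Type) (_ : Field F) (_ : CharZero F) (e : ℕ ≃ F),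
    IsFieldCopy A F e ∧ Algebra.trdeg ℚ F = r}

/-! ### Existential theories -/

/-- The existential theory of `A`: the set of existential first-order sentences true in `A`. -/
def existentialTheory {L : FirstOrder.Language.{0, 0}} [L.IsRelational] (A : Mod L) : Set L.Sentence :=
  {φ | FirstOrder.Language.BoundedFormula.IsExistential φ ∧
    @FirstOrder.Language.Sentence.Realize L ℕ A.toStructure φ}

/-- The set of polynomials `p` over `ℤ` such that `(∃ x) p(x) = 0` is true in the field `A`. -/
def rootSet (A : Mod fieldLang) : Set (Polynomial ℤ) :=
  {p | ∃ (F : Type) (_ : Field F) (e : ℕ ≃ F), IsFieldCopy A F e ∧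
    ∃ x : F, Polynomial.aeval x p = 0}

end FieldClasses

namespace FieldClasses

/-! ### Copies of algebraic structures and isomorphisms -/

/-! Smoothness passes down along Borel reductions. If isomorphism on `FD 1` reduced to isomorphism
on `FD 0`, then $E_0$, which reduces to the former, would be smooth, since the latter is. Fields in
`FD 0` are algebraic over $\mathbb{Q}$. If the same polynomials have roots in $F$ and $K$, every
finite subextension, being simple, embeds in the other field; compactness gives embeddings $F \to K$
and $K \to F$, and these are onto by algebraicity. So root sets classify
(`isoOn_FD_zero_iff_rootSet`). Existential theories determine root sets because checking $p(x)=0$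
involves only finitely many elements. $E_0$ is not smooth by Kolmogorov's zero-one law: an invariant
Borel map to $2^\omega$ is almost everywhere constant, while classes are countable and hence null.
For $E_0 \le \operatorname{TFAb}_1$, send $f$ to the subgroup of $\mathbb{Q}$ with squarefree
denominators built from the primes $p_n$, $f(n)=1$. A finite change of $f$ is undone by a rational
scaling; conversely the image of $1$ under an isomorphism has a numerator with only finitely many
prime divisors (`primeGroup_finite_sdiff`). For `FD 1` the same groups serve as exponents: take the
field generated by the $t^q$. Divisibility in the group becomes divisibility of degrees between
simple transcendental extensions (`RationalPowers.finite_sdiff`). -/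

theorem fin_three_eta (x : Fin 3 → ℕ) : ![x 0, x 1, x 2] = x := by
  ext i; fin_cases i <;> rfl

theorem comp_vec_three (f : ℕ → ℕ) (a b c : ℕ) : f ∘ ![a, b, c] = ![f a, f b, f c] := by
  ext i; fin_cases i <;> rfl

theorem IsGroupCopy.iso_iff {A B : Mod groupLang} {G H : Type} [AddCommGroup G] [AddCommGroup H]
    {e : ℕ ≃ G} {e' : ℕ ≃ H} (hA : IsGroupCopy A G e) (hB : IsGroupCopy B H e') :
    Mod.Iso A B ↔ Nonempty (G ≃+ H) := by
  constructor
  · rintro ⟨σ⟩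
    refine ⟨{ toEquiv := (e.symm.trans <| @FirstOrder.Language.Equiv.toEquiv groupLang ℕ ℕ
                A.toStructure B.toStructure σ).trans e',
              map_add' := fun x y => ?_ }⟩
    have h := (@FirstOrder.Language.Equiv.map_rel' groupLang ℕ ℕ A.toStructure B.toStructure σ 3
      GroupRel.add ![e.symm x, e.symm y, e.symm (x + y)]).2 ((hA _ _ _).2 (by simp))
    rw [comp_vec_three] at h
    exact ((hB _ _ _).1 h).symm
  · rintro ⟨σ⟩
    refine ⟨@FirstOrder.Language.Equiv.mk groupLang ℕ ℕ A.toStructure B.toStructure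
      ((e.trans σ.toEquiv).trans e'.symm) (fun f => isEmptyElim f) ?_⟩
    intro n r x
    cases r
    rw [← fin_three_eta x, Equiv.toFun_as_coe, comp_vec_three]
    refine (hB _ _ _).trans (Iff.trans ?_ (hA _ _ _).symm)
    simp [← map_add]

theorem IsFieldCopy.iso_iff {A B : Mod fieldLang} {F K : Type} [Field F] [Field K]
    {e : ℕ ≃ F} {e' : ℕ ≃ K} (hA : IsFieldCopy A F e) (hB : IsFieldCopy B K e') :
    Mod.Iso A B ↔ Nonempty (F ≃+* K) := by
  constructor
  · rintro ⟨σ⟩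
    refine ⟨{ toEquiv := (e.symm.trans <| @FirstOrder.Language.Equiv.toEquiv fieldLang ℕ ℕ
                A.toStructure B.toStructure σ).trans e',
              map_add' := fun x y => ?_,
              map_mul' := fun x y => ?_ }⟩
    · have h := (@FirstOrder.Language.Equiv.map_rel' fieldLang ℕ ℕ A.toStructure B.toStructure σ 3
        FieldRel.mul ![e.symm x, e.symm y, e.symm (x * y)]).2 ((hA.2 _ _ _).2 (by simp))
      rw [comp_vec_three] at h
      exact ((hB.2 _ _ _).1 h).symm
    · have h := (@FirstOrder.Language.Equiv.map_rel' fieldLang ℕ ℕ A.toStructure B.toStructure σ 3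
        FieldRel.add ![e.symm x, e.symm y, e.symm (x + y)]).2 ((hA.1 _ _ _).2 (by simp))
      rw [comp_vec_three] at h
      exact ((hB.1 _ _ _).1 h).symm
  · rintro ⟨σ⟩
    refine ⟨@FirstOrder.Language.Equiv.mk fieldLang ℕ ℕ A.toStructure B.toStructure
      ((e.trans σ.toEquiv).trans e'.symm) (fun f => isEmptyElim f) ?_⟩
    intro n r x
    cases r
    · rw [← fin_three_eta x, Equiv.toFun_as_coe, comp_vec_three]
      refine (hB.1 _ _ _).trans (Iff.trans ?_ (hA.1 _ _ _).symm)
      simp [← map_add]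
    · rw [← fin_three_eta x, Equiv.toFun_as_coe, comp_vec_three]
      refine (hB.2 _ _ _).trans (Iff.trans ?_ (hA.2 _ _ _).symm)
      simp [← map_mul]

theorem Mod.Iso.refl (A : Mod fieldLang) : Mod.Iso A A :=
  ⟨@FirstOrder.Language.Equiv.refl fieldLang ℕ A.toStructure⟩

/-- All fields copied by the same `A` are isomorphic, so any one of them may be used to test for
roots. -/
theorem IsFieldCopy.mem_rootSet_iff {A : Mod fieldLang} {F : Type} [Field F] {e : ℕ ≃ F}
    (hA : IsFieldCopy A F e) (p : Polynomial ℤ) :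
    p ∈ rootSet A ↔ ∃ x : F, Polynomial.aeval x p = 0 := by
  constructor
  · rintro ⟨K, _, e', hK, x, hx⟩
    obtain ⟨σ⟩ := (hK.iso_iff hA).1 (Mod.Iso.refl A)
    refine ⟨σ x, ?_⟩
    have h := Polynomial.aeval_algHom_apply (σ : K →+* F).toIntAlgHom x p
    rw [hx, map_zero] at h
    exact h
  · exact fun h => ⟨F, _, e, hA, h⟩

/-! ### Measurability of satisfaction and of polynomial evaluation -/

theorem measurable_atomic {L : FirstOrder.Language.{0, 0}} (K : Set (Mod L))
    (s : AtomicSentence L) : Measurable fun A : K => A.1 s = true :=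
  have h : Measurable fun A : K => A.1 s := (measurable_pi_apply s).comp measurable_subtype_coe
  h.eq_const true

/-- Terms of a relational language are variables, so atomic formulas read single bits; a quantifier
over `ℕ` is a countable intersection. -/
theorem measurable_realize {L : FirstOrder.Language.{0, 0}} [L.IsRelational] (K : Set (Mod L))
    {α : Type} {n : ℕ} (φ : L.BoundedFormula α n) (v : α → ℕ) (xs : Fin n → ℕ) :
    Measurable fun A : K =>
      @FirstOrder.Language.BoundedFormula.Realize L ℕ A.1.toStructure α n φ v xs := by
  have hterm : ∀ {m : ℕ} (t : L.Term (α ⊕ Fin m)), ∃ i, t = FirstOrder.Language.var i := by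
    intro m t
    cases t with
    | var i => exact ⟨i, rfl⟩
    | func f _ => exact isEmptyElim f
  induction φ with
  | falsum => exact measurable_const
  | equal t₁ t₂ =>
    obtain ⟨i, rfl⟩ := hterm t₁
    obtain ⟨j, rfl⟩ := hterm t₂
    exact (measurable_const : Measurable fun _ : K => Sum.elim v xs i = Sum.elim v xs j)
  | rel R ts =>
    choose i hi using fun k => hterm (ts k)
    obtain rfl : ts = fun k => FirstOrder.Language.var (i k) := funext hi
    exact measurable_atomic K ⟨_, R, fun k => Sum.elim v xs (i k)⟩
  | imp φ ψ h₁ h₂ => exact (h₁ xs).imp (h₂ xs)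
  | all φ h => exact Measurable.forall fun a => h (Fin.snoc xs a)

theorem measurable_existentialTheory {L : FirstOrder.Language.{0, 0}} [L.IsRelational]
    (K : Set (Mod L)) : Measurable fun A : K => existentialTheory A.1 := by
  rw [measurable_set_iff]
  intro φ
  exact Measurable.and measurable_const (measurable_realize K φ _ _)

/-- The value of an integer polynomial at an argument depends measurably on a copy of a field. -/
theorem measurable_aeval_eq {K : Set (Mod fieldLang)} {F : K → Type} [∀ A, Field (F A)]
    (e : ∀ A, ℕ ≃ F A) (he : ∀ A : K, IsFieldCopy A.1 (F A) (e A)) (p : Polynomial ℤ) (x y : ℕ) :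
    Measurable fun A : K => Polynomial.aeval (e A x) p = e A y := by
  have hadd : ∀ a b c, Measurable fun A : K => e A a + e A b = e A c := fun a b c => by
    simp_rw [← (he _).1]; exact measurable_atomic K _
  have hmul : ∀ a b c, Measurable fun A : K => e A a * e A b = e A c := fun a b c => by
    simp_rw [← (he _).2]; exact measurable_atomic K _
  -- The constants are not symbols: `0` is the only solution of $y+y=y$, and `1` the only nonzero
  -- idempotent.
  have hzero : ∀ y, Measurable fun A : K => 0 = e A y := fun y => by
    have h : ∀ A : K, 0 = e A y ↔ e A y + e A y = e A y := fun A => by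
      rw [add_eq_left]; exact eq_comm
    simp_rw [h]; exact hadd _ _ _
  have hone : ∀ y, Measurable fun A : K => 1 = e A y := fun y => by
    have h : ∀ A : K, 1 = e A y ↔ e A y * e A y = e A y ∧ ¬ 0 = e A y := fun A => by
      constructor
      · intro h; simp [← h]
      · rintro ⟨h, h0⟩
        exact ((mul_eq_left₀ (Ne.symm h0)).1 h).symm
    simp_rw [h]; exact (hmul _ _ _).and (hzero _).not
  -- Quantifying over the numbers that name the two summands turns the condition into a countable
  -- union.
  have hADD : ∀ u v : ∀ A, F A, (∀ y, Measurable fun A : K => u A = e A y) →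
      (∀ y, Measurable fun A : K => v A = e A y) →
      ∀ y, Measurable fun A : K => u A + v A = e A y := by
    intro u v hu hv y
    have h : ∀ A : K, u A + v A = e A y ↔
        ∃ a b, u A = e A a ∧ v A = e A b ∧ e A a + e A b = e A y := fun A => by
      constructor
      · exact fun h => ⟨(e A).symm (u A), (e A).symm (v A), by simp, by simp, by simpa using h⟩
      · rintro ⟨a, b, h₁, h₂, h₃⟩; rw [h₁, h₂, h₃]
    simp_rw [h]
    exact .exists fun a => .exists fun b => (hu a).and ((hv b).and (hadd _ _ _))
  have hMUL : ∀ u v : ∀ A, F A, (∀ y, Measurable fun A : K => u A = e A y) →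
      (∀ y, Measurable fun A : K => v A = e A y) →
      ∀ y, Measurable fun A : K => u A * v A = e A y := by
    intro u v hu hv y
    have h : ∀ A : K, u A * v A = e A y ↔
        ∃ a b, u A = e A a ∧ v A = e A b ∧ e A a * e A b = e A y := fun A => by
      constructor
      · exact fun h => ⟨(e A).symm (u A), (e A).symm (v A), by simp, by simp, by simpa using h⟩
      · rintro ⟨a, b, h₁, h₂, h₃⟩; rw [h₁, h₂, h₃]
    simp_rw [h]
    exact .exists fun a => .exists fun b => (hu a).and ((hv b).and (hmul _ _ _))
  have hNEG : ∀ u : ∀ A, F A, (∀ y, Measurable fun A : K => u A = e A y) →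
      ∀ y, Measurable fun A : K => - u A = e A y := by
    intro u hu y
    have h : ∀ A : K, - u A = e A y ↔
        ∃ a b, u A = e A a ∧ 0 = e A b ∧ e A a + e A y = e A b := fun A => by
      constructor
      · exact fun h => ⟨(e A).symm (u A), (e A).symm 0, by simp, by simp, by simp [← h]⟩
      · rintro ⟨a, b, h₁, h₂, h₃⟩
        rw [← h₂, ← h₁] at h₃
        exact neg_eq_of_add_eq_zero_right h₃
    simp_rw [h]
    exact .exists fun a => .exists fun b => (hu a).and ((hzero b).and (hadd _ _ _))
  have hint : ∀ (n : ℤ) y, Measurable fun A : K => (n : F A) = e A y := by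
    intro n
    induction n using Int.induction_on with
    | zero => simpa using hzero
    | succ n ih => intro y; push_cast; exact hADD _ _ (by simpa using ih) hone y
    | pred n ih =>
      intro y
      push_cast
      simp_rw [sub_eq_add_neg]
      exact hADD _ _ (by simpa using ih) (hNEG _ hone) y
  have key : ∀ y, Measurable fun A : K => Polynomial.aeval (e A x) p = e A y := by
    induction p using Polynomial.induction_on with
    | C n => simpa using hint n
    | add p q hp hq => intro y; simp only [map_add]; exact hADD _ _ hp hq y
    | monomial n c ih =>
      intro y
      simp only [pow_succ, ← mul_assoc]
      simp only [map_mul (Polynomial.aeval _) _ Polynomial.X, Polynomial.aeval_X]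
      refine hMUL _ _ ih (fun y => ?_) y
      simp only [EmbeddingLike.apply_eq_iff_eq]
      exact measurable_const
  exact key y

theorem measurable_rootSet : Measurable fun A : FD 0 => rootSet A.1 := by
  rw [measurable_set_iff]
  intro p
  choose F hF _ e he _ using fun A : FD 0 => A.2
  have h : ∀ A : FD 0, p ∈ rootSet A.1 ↔
      ∃ x y, Polynomial.aeval (e A x) p = e A y ∧ e A y + e A y = e A y := fun A => by
    rw [(he A).mem_rootSet_iff]
    constructor
    · rintro ⟨x, hx⟩
      exact ⟨(e A).symm x, (e A).symm 0, by simpa using hx, by simp⟩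
    · rintro ⟨x, y, h₁, h₂⟩
      exact ⟨e A x, by rw [h₁]; simpa using h₂⟩
  simp_rw [h]
  refine .exists fun x => .exists fun y => (measurable_aeval_eq e he p x y).and ?_
  simp_rw [← (he _).1]
  exact measurable_atomic _ _

/-! ### Existential theories determine root sets -/

section PartialEmbedding

open FirstOrder.Language FirstOrder.Language.BoundedFormula

theorem isQF_iInf {L : FirstOrder.Language.{0, 0}} {α β : Type} [Finite β] {n : ℕ}
    (f : β → L.BoundedFormula α n) (hf : ∀ b, (f b).IsQF) : (BoundedFormula.iInf f).IsQF := by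
  rw [BoundedFormula.iInf]
  generalize Finset.toList _ = l
  induction l with
  | nil => exact IsQF.top
  | cons b l ih => exact (hf b).inf ih

theorem isExistential_exs {L : FirstOrder.Language.{0, 0}} {α : Type} {n : ℕ}
    {φ : L.BoundedFormula α n} (h : φ.IsExistential) :
    BoundedFormula.IsExistential φ.exs := by
  induction n with
  | zero => exact h
  | succ n ih => exact ih h.ex

/-- A finite part of `A` embeds in `B` if the existential sentences true in `A` are true in `B`. -/
theorem exists_finite_partial_embedding {L : FirstOrder.Language.{0, 0}} [L.IsRelational]
    {A B : Mod L} (h : existentialTheory A ⊆ existentialTheory B) {m : ℕ} [Finite (L.Relations m)]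
    {n : ℕ} (a : Fin n → ℕ) (ha : Function.Injective a) :
    ∃ b : Fin n → ℕ, Function.Injective b ∧ ∀ (R : L.Relations m) (i : Fin m → Fin n),
      A ⟨m, R, a ∘ i⟩ = true → B ⟨m, R, b ∘ i⟩ = true := by
  classical
  -- Only positive facts of arity `m` are recorded, together with inequations for injectivity. The
  -- conjunction is finite because `L.Relations m` is.
  let lit : L.Relations m × (Fin m → Fin n) → L.BoundedFormula Empty n := fun t =>
    if A ⟨m, t.1, a ∘ t.2⟩ = true then rel t.1 fun k => var (Sum.inr (t.2 k)) else ⊤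
  let ne : Fin n × Fin n → L.BoundedFormula Empty n := fun t =>
    if t.1 = t.2 then ⊤ else (BoundedFormula.equal (var (Sum.inr t.1)) (var (Sum.inr t.2))).not
  let φ : L.BoundedFormula Empty n := BoundedFormula.iInf lit ⊓ BoundedFormula.iInf ne
  have hφ : φ.IsQF := by
    refine (isQF_iInf _ fun t => ?_).inf (isQF_iInf _ fun t => ?_)
    · dsimp only [lit]
      split_ifs
      · exact (IsAtomic.rel _ _).isQF
      · exact IsQF.top
    · dsimp only [ne]
      split_ifs
      · exact IsQF.top
      · exact (IsAtomic.equal _ _).isQF.not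
  have hreal : ∀ (C : Mod L) (c : Fin n → ℕ) (v : Empty → ℕ),
      @BoundedFormula.Realize L ℕ C.toStructure _ _ φ v c ↔
      (∀ (R : L.Relations m) (i : Fin m → Fin n),
        A ⟨m, R, a ∘ i⟩ = true → C ⟨m, R, c ∘ i⟩ = true) ∧ Function.Injective c := by
    intro C c v
    let := C.toStructure
    rw [realize_inf, realize_iInf, realize_iInf, Prod.forall, Prod.forall]
    refine and_congr (forall₂_congr fun R i => ?_) (forall₂_congr fun i j => ?_)
    · dsimp only [lit]
      split_ifs with hA
      · simp only [hA, true_imp_iff]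
        exact Iff.rfl
      · simp [hA]
    · dsimp only [ne]
      split_ifs with hij
      · simp [hij]
      · rw [realize_not]
        exact ⟨fun h h' => (h h').elim, fun h h' => hij (h h')⟩
  have hA : φ.exs ∈ existentialTheory A := by
    refine ⟨isExistential_exs hφ.isExistential, ?_⟩
    exact (@realize_exs L ℕ A.toStructure _ _ _ _).2 ⟨a, (hreal A a _).2 ⟨fun _ _ h => h, ha⟩⟩
  obtain ⟨b, hb⟩ := (@realize_exs L ℕ B.toStructure _ _ _ _).1 (h hA).2
  exact ⟨b, ((hreal B b _).1 hb).2, ((hreal B b _).1 hb).1⟩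

end PartialEmbedding

/-- `g` is injective on `S` and respects the sums and products whose terms all lie in `S`. -/
structure IsPartialRingEmb {F K : Type} [Field F] [Field K] (S : Finset F) (g : F → K) : Prop where
  inj : ∀ a ∈ S, ∀ b ∈ S, g a = g b → a = b
  add : ∀ a ∈ S, ∀ b ∈ S, a + b ∈ S → g (a + b) = g a + g b
  mul : ∀ a ∈ S, ∀ b ∈ S, a * b ∈ S → g (a * b) = g a * g b

theorem IsPartialRingEmb.mono {F K : Type} [Field F] [Field K] {S T : Finset F} {g : F → K}
    (h : IsPartialRingEmb T g) (hST : S ⊆ T) : IsPartialRingEmb S g where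
  inj a ha b hb := h.inj a (hST ha) b (hST hb)
  add a ha b hb hab := h.add a (hST ha) b (hST hb) (hST hab)
  mul a ha b hb hab := h.mul a (hST ha) b (hST hb) (hST hab)

theorem IsPartialRingEmb.map_zero {F K : Type} [Field F] [Field K] {S : Finset F} {g : F → K}
    (h : IsPartialRingEmb S g) (h0 : 0 ∈ S) : g 0 = 0 := by
  have := h.add 0 h0 0 h0 (by simpa using h0)
  simpa using this

theorem IsPartialRingEmb.map_one {F K : Type} [Field F] [Field K] {S : Finset F} {g : F → K}
    (h : IsPartialRingEmb S g) (h0 : 0 ∈ S) (h1 : 1 ∈ S) : g 1 = 1 := by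
  have h2 := h.mul 1 h1 1 h1 (by simpa using h1)
  have h3 : g 1 ≠ 0 := fun h4 => one_ne_zero (h.inj 1 h1 0 h0 (h4.trans (h.map_zero h0).symm))
  rw [mul_one] at h2
  exact (mul_eq_left₀ h3).1 h2.symm

/-- A partial embedding on a large enough finite set commutes with the evaluation of `p` at `x`. -/
theorem exists_finset_map_aeval {F : Type} [Field F] (p : Polynomial ℤ) (x : F) :
    ∃ S : Finset F, ∀ {K : Type} [Field K] (g : F → K), IsPartialRingEmb S g →
      g (Polynomial.aeval x p) = Polynomial.aeval (g x) p := by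
  classical
  have hint : ∀ n : ℤ, ∃ S : Finset F, ∀ {K : Type} [Field K] (g : F → K),
      IsPartialRingEmb S g → g (n : F) = n := by
    intro n
    induction n using Int.induction_on with
    | zero => exact ⟨{0}, fun g hg => by simpa using hg.map_zero (by simp)⟩
    | succ n ih =>
      obtain ⟨S, hS⟩ := ih
      refine ⟨S ∪ {0, 1, (n : F), (n : F) + 1}, fun g hg => ?_⟩
      have h1 := hS g (hg.mono Finset.subset_union_left)
      have h2 := hg.add n (by simp) 1 (by simp) (by simp)
      rw [hg.map_one (by simp) (by simp)] at h2
      push_cast at h1 ⊢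
      rw [h2, h1]
    | pred n ih =>
      obtain ⟨S, hS⟩ := ih
      -- Partial embeddings respect sums only, so the value at $-n-1$ is recovered from
      -- $(-n-1)+1=-n$.
      refine ⟨S ∪ {0, 1, -(n : F), -(n : F) - 1}, fun g hg => ?_⟩
      have h1 := hS g (hg.mono Finset.subset_union_left)
      have h2 := hg.add (-(n : F) - 1) (by simp) 1 (by simp) (by simp)
      rw [hg.map_one (by simp) (by simp), sub_add_cancel] at h2
      push_cast at h1 ⊢
      rw [eq_sub_iff_add_eq, ← h2, h1]
  induction p using Polynomial.induction_on with
  | C n => simpa using hint n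
  | add p q hp hq =>
    obtain ⟨S, hS⟩ := hp
    obtain ⟨T, hT⟩ := hq
    refine ⟨S ∪ T ∪ {Polynomial.aeval x p, Polynomial.aeval x q,
      Polynomial.aeval x p + Polynomial.aeval x q}, fun g hg => ?_⟩
    rw [map_add, hg.add _ (by simp) _ (by simp) (by simp), map_add,
      hS g (hg.mono fun a ha => by simp [ha]), hT g (hg.mono fun a ha => by simp [ha])]
  | monomial n c ih =>
    obtain ⟨S, hS⟩ := ih
    refine ⟨S ∪ {x, Polynomial.aeval x (Polynomial.C c * Polynomial.X ^ n),
      Polynomial.aeval x (Polynomial.C c * Polynomial.X ^ n) * x}, fun g hg => ?_⟩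
    rw [pow_succ, ← mul_assoc, map_mul _ _ Polynomial.X, Polynomial.aeval_X,
      hg.mul _ (by simp) _ (by simp) (by simp), map_mul _ _ Polynomial.X, Polynomial.aeval_X,
      hS g (hg.mono fun a ha => by simp [ha])]

instance (m : ℕ) : Finite (fieldLang.Relations m) := by
  refine Finite.of_injective (β := Bool) (fun r => match r with | .add => true | .mul => false) ?_
  intro r s h
  cases r <;> cases s <;> simp_all

theorem rootSet_subset_of_existentialTheory_subset {A B : Mod fieldLang} {F K : Type}
    [Field F] [Field K] {e : ℕ ≃ F} {e' : ℕ ≃ K} (hA : IsFieldCopy A F e) (hB : IsFieldCopy B K e')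
    (h : existentialTheory A ⊆ existentialTheory B) : rootSet A ⊆ rootSet B := by
  classical
  intro p hp
  obtain ⟨x, hx⟩ := (hA.mem_rootSet_iff p).1 hp
  obtain ⟨S, hS⟩ := exists_finset_map_aeval p x
  -- With `0` in the domain, `g` must send the value $p(x)=0$ to `0`.
  let T := insert 0 S
  let a : Fin T.card → ℕ := fun i => e.symm (T.equivFin.symm i)
  have ha : Function.Injective a :=
    e.symm.injective.comp (Subtype.val_injective.comp T.equivFin.symm.injective)
  obtain ⟨b, hb, hR⟩ := exists_finite_partial_embedding (m := 3) h a ha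
  -- The value off `T` is immaterial, even if `x` lies outside `T`: `hS` only asks that `g` be a
  -- partial embedding on `S`.
  let g : F → K := fun y => if hy : y ∈ T then e' (b (T.equivFin ⟨y, hy⟩)) else 0
  have hgT : ∀ y (hy : y ∈ T), g y = e' (b (T.equivFin ⟨y, hy⟩)) := fun y hy => dif_pos hy
  have haT : ∀ y (hy : y ∈ T), e (a (T.equivFin ⟨y, hy⟩)) = y := fun y hy => by simp [a]
  have hg : IsPartialRingEmb T g := by
    refine ⟨fun u hu v hv huv => ?_, fun u hu v hv huv => ?_, fun u hu v hv huv => ?_⟩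
    · rw [hgT u hu, hgT v hv] at huv
      have := T.equivFin.injective (hb (e'.injective huv))
      exact congrArg Subtype.val this
    · have h1 := hR FieldRel.add ![T.equivFin ⟨u, hu⟩, T.equivFin ⟨v, hv⟩, T.equivFin ⟨_, huv⟩]
      rw [← fin_three_eta (a ∘ _), ← fin_three_eta (b ∘ _)] at h1
      rw [hgT u hu, hgT v hv, hgT _ huv]
      exact ((hB.1 _ _ _).1 (h1 ((hA.1 _ _ _).2 (by simp [haT])))).symm
    · have h1 := hR FieldRel.mul ![T.equivFin ⟨u, hu⟩, T.equivFin ⟨v, hv⟩, T.equivFin ⟨_, huv⟩]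
      rw [← fin_three_eta (a ∘ _), ← fin_three_eta (b ∘ _)] at h1
      rw [hgT u hu, hgT v hv, hgT _ huv]
      exact ((hB.2 _ _ _).1 (h1 ((hA.2 _ _ _).2 (by simp [haT])))).symm
  refine (hB.mem_rootSet_iff p).2 ⟨g x, ?_⟩
  rw [← hS g (hg.mono (Finset.subset_insert _ _)), hx]
  exact hg.map_zero (Finset.mem_insert_self _ _)

/-! ### Isomorphism of algebraic fields of characteristic zero -/

theorem existentialTheory_subset_of_iso {L : FirstOrder.Language.{0, 0}} [L.IsRelational]
    {A B : Mod L} (h : Mod.Iso A B) : existentialTheory A ⊆ existentialTheory B := by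
  obtain ⟨σ⟩ := h
  rintro φ ⟨h₁, h₂⟩
  refine ⟨h₁, ?_⟩
  exact (@FirstOrder.Language.StrongHomClass.realize_sentence L ℕ ℕ A.toStructure B.toStructure
    _ _ (@FirstOrder.Language.Equiv.instStrongHomClass L ℕ ℕ A.toStructure B.toStructure) σ φ).1 h₂

theorem Mod.Iso.symm {L : FirstOrder.Language.{0, 0}} [L.IsRelational]
    {A B : Mod L} (h : Mod.Iso A B) : Mod.Iso B A := by
  obtain ⟨σ⟩ := h
  exact ⟨@FirstOrder.Language.Equiv.symm L ℕ ℕ A.toStructure B.toStructure σ⟩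

theorem nonempty_ringEquiv_of_exists_root_iff {F K : Type} [Field F] [Field K] [CharZero F]
    [CharZero K] [Algebra.IsAlgebraic ℚ F] [Algebra.IsAlgebraic ℚ K]
    (h : ∀ p : Polynomial ℤ, (∃ x : F, Polynomial.aeval x p = 0) ↔
      ∃ x : K, Polynomial.aeval x p = 0) : Nonempty (F ≃+* K) := by
  -- Denominators are cleared: a nonzero integer multiple of `p` has the same roots in
  -- characteristic zero.
  have hclear : ∀ p : Polynomial ℚ, ∃ q : Polynomial ℤ, ∀ (E : Type) [Field E] [CharZero E] (x : E),
      Polynomial.aeval x p = 0 ↔ Polynomial.aeval x q = 0 := by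
    intro p
    refine ⟨IsLocalization.integerNormalization (nonZeroDivisors ℤ) p, fun E _ _ x => ?_⟩
    obtain ⟨b, hb, hp⟩ := IsLocalization.integerNormalization_spec (nonZeroDivisors ℤ) p
    have hb0 : (b : ℤ) ≠ 0 := nonZeroDivisors.ne_zero hb
    rw [← Polynomial.aeval_map_algebraMap ℚ x (IsLocalization.integerNormalization _ p), hp]
    simp [hb0]
  obtain ⟨σ⟩ := Field.nonempty_algEquiv_of_aeval_eq_zero_eq (F := ℚ) (E := F) (K := K) (by
    ext p
    obtain ⟨q, hq⟩ := hclear p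
    simp only [Set.mem_ofPred_eq, hq]
    exact h q)
  exact ⟨σ.toRingEquiv⟩

theorem isoOn_FD_zero_iff_rootSet (A B : FD 0) :
    isoOn (FD 0) A B ↔ rootSet A.1 = rootSet B.1 := by
  obtain ⟨F, _, _, e, he, hF⟩ := A.2
  obtain ⟨K, _, _, e', he', hK⟩ := B.2
  rw [isoOn, he.iso_iff he']
  constructor
  · rintro ⟨σ⟩
    ext p
    rw [he.mem_rootSet_iff, he'.mem_rootSet_iff]
    constructor
    · rintro ⟨x, hx⟩
      refine ⟨σ x, ?_⟩
      have h := Polynomial.aeval_algHom_apply (σ : F →+* K).toIntAlgHom x p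
      rw [hx, map_zero] at h
      exact h
    · rintro ⟨x, hx⟩
      refine ⟨σ.symm x, ?_⟩
      have h := Polynomial.aeval_algHom_apply (σ.symm : K →+* F).toIntAlgHom x p
      rw [hx, map_zero] at h
      exact h
  · intro h
    have := trdeg_eq_zero_iff.1 (by simpa using hF)
    have := trdeg_eq_zero_iff.1 (by simpa using hK)
    refine nonempty_ringEquiv_of_exists_root_iff fun p => ?_
    rw [← he.mem_rootSet_iff, ← he'.mem_rootSet_iff, h]

theorem isoOn_FD_zero_iff_existentialTheory (A B : FD 0) :
    isoOn (FD 0) A B ↔ existentialTheory A.1 = existentialTheory B.1 := by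
  constructor
  · exact fun h => (existentialTheory_subset_of_iso h).antisymm
      (existentialTheory_subset_of_iso (Mod.Iso.symm h))
  · intro h
    obtain ⟨F, _, _, e, he, hF⟩ := A.2
    obtain ⟨K, _, _, e', he', hK⟩ := B.2
    rw [isoOn_FD_zero_iff_rootSet]
    exact (rootSet_subset_of_existentialTheory_subset he he' h.le).antisymm
      (rootSet_subset_of_existentialTheory_subset he' he h.ge)

theorem countable_polynomial_int : Countable (Polynomial ℤ) := by
  rw [← Cardinal.mk_le_aleph0_iff]
  exact Polynomial.cardinalMk_le_max.trans (by simp)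

theorem smooth_isoOn_FD_zero : Smooth (isoOn (FD 0)) := by
  classical
  have := countable_polynomial_int
  obtain ⟨q, hq⟩ := exists_surjective_nat (Polynomial ℤ)
  refine ⟨fun A n => decide (q n ∈ rootSet A.1), ?_, fun A B => ?_⟩
  · refine measurable_pi_iff.2 fun n => ?_
    exact (measurable_of_countable fun P : Prop => decide P).comp
      (measurable_set_iff.1 measurable_rootSet (q n))
  · simp [isoOn_FD_zero_iff_rootSet, funext_iff, Set.ext_iff, hq.forall]

/-! ### `E₀` is not smooth -/

section Ergodic

open MeasureTheory ProbabilityTheory Filter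

/-- The fair coin measure on the Cantor space. -/
noncomputable def coinMeasure : Measure (ℕ → Bool) :=
  Measure.infinitePi fun _ => uniformOn Set.univ

instance : IsProbabilityMeasure (uniformOn (Set.univ : Set Bool)) :=
  isProbabilityMeasure_uniformOn Set.finite_univ Set.univ_nonempty

instance : IsProbabilityMeasure coinMeasure := by
  unfold coinMeasure; infer_instance

/-- Fixing the first `n` bits already cuts the measure down to $2^{-n}$. -/
theorem coinMeasure_singleton (f : ℕ → Bool) : coinMeasure {f} = 0 := by
  have hle : ∀ n : ℕ, coinMeasure {f} ≤ (1 / 2) ^ n := by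
    intro n
    have h : {f} ⊆ (Finset.range n : Set ℕ).pi fun i => {f i} := by
      rintro g rfl i _; rfl
    refine (measure_mono h).trans ?_
    rw [coinMeasure, Measure.infinitePi_pi _ fun _ _ => MeasurableSet.singleton _]
    have hs : ∀ b : Bool, uniformOn (Set.univ : Set Bool) {b} = 1 / 2 := fun b => by
      rw [uniformOn_univ]; simp
    simp only [hs, Finset.prod_const, Finset.card_range, le_refl]
  refine le_antisymm (ge_of_tendsto' (ENNReal.tendsto_pow_atTop_nhds_zero_of_lt_one ?_) hle) zero_le
  simp

/-- A measurable set that is invariant under finite changes has measure `0` or `1`. -/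
theorem coinMeasure_zero_or_one {S : Set (ℕ → Bool)} (hS : MeasurableSet S)
    (hinv : ∀ f g, E0 f g → (f ∈ S ↔ g ∈ S)) : coinMeasure S = 0 ∨ coinMeasure S = 1 := by
  let s : ℕ → MeasurableSpace (ℕ → Bool) := fun n =>
    MeasurableSpace.comap (fun f => f n) inferInstance
  have hind : iIndep s coinMeasure :=
    iIndepFun_infinitePi (P := fun _ : ℕ => uniformOn (Set.univ : Set Bool))
      (X := fun _ b => b) fun _ => measurable_id
  refine measure_zero_or_one_of_measurableSet_limsup_atTop (s := s)
    (fun n => (measurable_pi_apply n).comap_le) hind ?_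
  rw [limsup_eq_iInf_iSup_of_nat, MeasurableSpace.measurableSet_iInf]
  intro n
  -- Erasing the first `n` bits is measurable for the tail after `n`. By invariance `S` is its own
  -- preimage under `π`, so `S` lies in every tail σ-algebra.
  let π : (ℕ → Bool) → ℕ → Bool := fun f k => if k < n then false else f k
  have hπ : Measurable[⨆ i ≥ n, s i] π := by
    refine @measurable_pi_lambda _ _ _ (⨆ i ≥ n, s i) _ _ fun k => ?_
    by_cases hk : k < n
    · simp only [π, hk, if_true]
      exact @measurable_const _ _ _ (⨆ i ≥ n, s i) _
    · simp only [π, hk, if_false]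
      exact (comap_measurable (m := inferInstance) fun f : ℕ → Bool => f k).mono
        (le_iSup₂ (f := fun i (_ : i ≥ n) => s i) k (not_lt.1 hk)) le_rfl
  have hSπ : S = π ⁻¹' S := by
    ext f
    refine hinv _ _ ?_
    filter_upwards [eventually_ge_atTop n] with k hk
    simp [π, not_lt.2 hk]
  rw [hSπ]
  exact hπ hS

theorem countable_setOf_E0 (g : ℕ → Bool) : {f | E0 f g}.Countable := by
  have h : {f | E0 f g} ⊆ Set.range fun p : Finset ℕ × Finset ℕ =>
      fun n => if n ∈ p.1 then decide (n ∈ p.2) else g n := by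
    intro f hf
    obtain ⟨N, hN⟩ := eventually_atTop.1 hf
    refine ⟨(Finset.range N, (Finset.range N).filter fun n => f n = true), ?_⟩
    ext n
    by_cases hn : n < N
    · simp [hn]
    · simp [hn, hN n (not_lt.1 hn)]
  exact (Set.countable_range _).mono h

/-- By the zero-one law each bit of a reduction is almost everywhere constant. A conull set of
points then lies in one class, which is countable and hence null. -/
theorem not_smooth_E0 : ¬ Smooth E0 := by
  rintro ⟨Φ, hΦ, h⟩
  have hm : ∀ n b, MeasurableSet {f | Φ f n = b} := fun n b =>
    ((measurable_pi_apply n).comp hΦ) (MeasurableSet.singleton b)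
  have hex : ∀ n, ∃ b, ∀ᵐ f ∂coinMeasure, Φ f n = b := by
    intro n
    rcases coinMeasure_zero_or_one (hm n true)
      (fun f g hfg => by simp [(h f g).1 hfg]) with h0 | h1
    · refine ⟨false, ?_⟩
      rw [ae_iff]
      simpa using h0
    · exact ⟨true, (prob_compl_eq_zero_iff (hm n true)).2 h1⟩
  choose b hb using hex
  have hall : ∀ᵐ f ∂coinMeasure, Φ f = b := by
    filter_upwards [ae_all_iff.2 hb] with f hf using funext hf
  obtain ⟨g, hg⟩ := hall.exists
  have hnull : coinMeasure {f | E0 f g} = 0 := by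
    rw [← Set.biUnion_of_singleton {f | E0 f g}, measure_biUnion_null_iff (countable_setOf_E0 g)]
    exact fun f _ => coinMeasure_singleton f
  have : ∀ᵐ f ∂coinMeasure, False := by
    filter_upwards [hall, measure_eq_zero_iff_ae_notMem.1 hnull] with f hf hf'
    exact hf' ((h f g).2 (hf.trans hg.symm))
  simp at this
  exact IsProbabilityMeasure.ne_zero coinMeasure this

end Ergodic

/-! ### Measurable families of countable algebraic structures -/

theorem measurable_count_eq {X : Type} [MeasurableSpace X] (P : X → ℕ → Prop)
    [∀ x, DecidablePred (P x)] (hP : ∀ k, Measurable fun x => P x k) (k n : ℕ) :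
    Measurable fun x => Nat.count (P x) k = n := by
  induction k generalizing n with
  | zero => simp only [Nat.count_zero]; exact measurable_const
  | succ k ih =>
    have h : ∀ x, Nat.count (P x) (k + 1) = n ↔
        (P x k ∧ Nat.count (P x) k + 1 = n) ∨ (¬ P x k ∧ Nat.count (P x) k = n) := fun x => by
      rw [Nat.count_succ]
      by_cases hx : P x k <;> simp [hx]
    simp_rw [h]
    refine ((hP k).and ?_).or ((hP k).not.and (ih n))
    cases n with
    | zero => simp only [Nat.succ_ne_zero]; exact measurable_const
    | succ n => simp only [Nat.add_right_cancel_iff]; exact ih n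

/-- A measurable family of infinite subsets of a countable type has a measurable enumeration. -/
theorem exists_measurable_enumeration {X Ω : Type} [MeasurableSpace X] [Countable Ω]
    (H : X → Set Ω) (hinf : ∀ x, (H x).Infinite) (hm : ∀ w, Measurable fun x => w ∈ H x) :
    ∃ e : ∀ x, ℕ ≃ H x, ∀ n w, Measurable fun x => (e x n : Ω) = w := by
  classical
  obtain ⟨c, hc⟩ := exists_injective_nat Ω
  let P : X → ℕ → Prop := fun x k => k ∈ c '' H x
  have hP : ∀ k, Measurable fun x => P x k := fun k =>
    .exists fun w => (hm w).and measurable_const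
  have hPinf : ∀ x, (Set.ofPred (P x)).Infinite := fun x => (hinf x).image hc.injOn
  choose g hg hgc using fun x n => (Nat.nth_mem_of_infinite (hPinf x) n : P x (Nat.nth (P x) n))
  have hbij : ∀ x, Function.Bijective fun n => (⟨g x n, hg x n⟩ : H x) := by
    refine fun x => ⟨fun m n hmn => ?_, fun w => ?_⟩
    · have h : g x m = g x n := congrArg Subtype.val hmn
      exact Nat.nth_injective (hPinf x) (by rw [← hgc, ← hgc, h])
    · have hw : c w ∈ Set.range (Nat.nth (P x)) := by
        rw [Nat.range_nth_of_infinite (hPinf x)]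
        exact ⟨w, w.2, rfl⟩
      obtain ⟨n, hn⟩ := hw
      exact ⟨n, Subtype.ext (hc ((hgc x n).trans hn))⟩
  refine ⟨fun x => Equiv.ofBijective _ (hbij x), fun n w => ?_⟩
  -- A member is the `n`-th exactly when `n` members have smaller codes, so measurability reduces to
  -- that of a count.
  have h : ∀ x, g x n = w ↔ P x (c w) ∧ Nat.count (P x) (c w) = n := fun x => by
    rw [← hc.eq_iff, hgc]
    constructor
    · intro h
      rw [← h]
      exact ⟨Nat.nth_mem_of_infinite (hPinf x) n, Nat.count_nth_of_infinite (hPinf x) n⟩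
    · rintro ⟨h₁, rfl⟩
      exact Nat.nth_count h₁
  simp only [Equiv.ofBijective_apply, h]
  exact (hP _).and (measurable_count_eq P hP _ _)

theorem measurable_op_eq {X Ω : Type} [MeasurableSpace X] [Countable Ω] (op : Ω → Ω → Ω)
    {g : X → ℕ → Ω} (hg : ∀ n w, Measurable fun x => g x n = w) (a b c : ℕ) :
    Measurable fun x => op (g x a) (g x b) = g x c := by
  have h : ∀ x, op (g x a) (g x b) = g x c ↔ ∃ u v, g x a = u ∧ g x b = v ∧ g x c = op u v := by
    intro x
    exact ⟨fun h => ⟨_, _, rfl, rfl, h.symm⟩, by rintro ⟨u, v, rfl, rfl, h⟩; exact h.symm⟩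
  simp_rw [h]
  exact .exists fun u => .exists fun v => (hg _ _).and ((hg _ _).and (hg _ _))

/-- A measurable family of infinite subgroups of a countable group gives a measurable family of
structures. -/
theorem exists_measurable_groupCopy {X Ω : Type} [MeasurableSpace X] [Countable Ω]
    [AddCommGroup Ω] (H : X → AddSubgroup Ω) (hinf : ∀ x, (H x : Set Ω).Infinite)
    (hm : ∀ w, Measurable fun x => w ∈ H x) :
    ∃ Φ : X → Mod groupLang, Measurable Φ ∧ ∀ x, ∃ e : ℕ ≃ H x, IsGroupCopy (Φ x) (H x) e := by
  classical
  obtain ⟨e, he⟩ := exists_measurable_enumeration (fun x => (H x : Set Ω)) hinf hm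
  refine ⟨fun x s => match s with
    | ⟨_, GroupRel.add, a⟩ => decide ((e x (a 0) : Ω) + e x (a 1) = e x (a 2)), ?_, fun x => ?_⟩
  · refine measurable_pi_iff.2 ?_
    rintro ⟨n, R, a⟩
    cases R
    exact (measurable_of_countable fun P : Prop => decide P).comp
      (measurable_op_eq (· + ·) he (a 0) (a 1) (a 2))
  · refine ⟨e x, fun a b c => ?_⟩
    simp only [decide_eq_true_eq]
    exact (Subtype.ext_iff (a1 := (e x a + e x b : H x))).symm

/-- A measurable family of infinite subfields of a countable field gives a measurable family of
structures. -/
theorem exists_measurable_fieldCopy {X k Ω : Type} [MeasurableSpace X] [Countable Ω] [Field k]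
    [Field Ω] [Algebra k Ω] (H : X → IntermediateField k Ω) (hinf : ∀ x, (H x : Set Ω).Infinite)
    (hm : ∀ w, Measurable fun x => w ∈ H x) :
    ∃ Φ : X → Mod fieldLang, Measurable Φ ∧ ∀ x, ∃ e : ℕ ≃ H x, IsFieldCopy (Φ x) (H x) e := by
  classical
  obtain ⟨e, he⟩ := exists_measurable_enumeration (fun x => (H x : Set Ω)) hinf hm
  refine ⟨fun x s => match s with
    | ⟨_, FieldRel.add, a⟩ => decide ((e x (a 0) : Ω) + e x (a 1) = e x (a 2))
    | ⟨_, FieldRel.mul, a⟩ => decide ((e x (a 0) : Ω) * e x (a 1) = e x (a 2)), ?_, fun x => ?_⟩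
  · refine measurable_pi_iff.2 ?_
    rintro ⟨n, R, a⟩
    cases R
    · exact (measurable_of_countable fun P : Prop => decide P).comp
        (measurable_op_eq (· + ·) he (a 0) (a 1) (a 2))
    · exact (measurable_of_countable fun P : Prop => decide P).comp
        (measurable_op_eq (· * ·) he (a 0) (a 1) (a 2))
  · refine ⟨e x, fun a b c => ?_, fun a b c => ?_⟩ <;> simp only [decide_eq_true_eq]
    · exact (Subtype.ext_iff (a1 := (e x a + e x b : H x))).symm
    · exact (Subtype.ext_iff (a1 := (e x a * e x b : H x))).symm

/-! ### The subgroup of the rationals attached to a set of primes -/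

/-- The product of the `n`-th primes, `n ∈ s`. -/
noncomputable def primeProd (s : Finset ℕ) : ℕ := ∏ n ∈ s, Nat.nth Nat.Prime n

theorem prime_nth (n : ℕ) : (Nat.nth Nat.Prime n).Prime :=
  Nat.prime_nth_prime n

theorem primeProd_ne_zero (s : Finset ℕ) : primeProd s ≠ 0 :=
  Finset.prod_ne_zero_iff.2 fun n _ => (prime_nth n).ne_zero

theorem primeProd_sdiff_mul {s t : Finset ℕ} (h : s ⊆ t) :
    primeProd (t \ s) * primeProd s = primeProd t :=
  Finset.prod_sdiff h

theorem mem_of_dvd_primeProd {n : ℕ} {s : Finset ℕ} (h : Nat.nth Nat.Prime n ∣ primeProd s) :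
    n ∈ s := by
  obtain ⟨m, hm, hd⟩ := (Prime.dvd_finsetProd_iff (prime_nth n).prime _).1 h
  rwa [Nat.nth_injective Nat.infinite_setOfPred_prime
    ((Nat.prime_dvd_prime_iff_eq (prime_nth n) (prime_nth m)).1 hd)]

/-- All members of `s` belong to the set with characteristic function `f`. -/
def Supported (f : ℕ → Bool) (s : Finset ℕ) : Prop := ∀ n ∈ s, f n = true

theorem Supported.union {f : ℕ → Bool} {s t : Finset ℕ} (hs : Supported f s) (ht : Supported f t) :
    Supported f (s ∪ t) := fun n hn =>
  (Finset.mem_union.1 hn).elim (hs n) (ht n)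

theorem supported_empty (f : ℕ → Bool) : Supported f ∅ := fun n hn => by simp at hn

theorem measurable_supported (s : Finset ℕ) : Measurable fun f => Supported f s :=
  .forall fun n => measurable_const.imp <|
    Measurable.eq_const (f := fun f : ℕ → Bool => f n) (measurable_pi_apply n) true

theorem mul_primeProd_mono {q : ℚ} {s t : Finset ℕ} (hst : s ⊆ t)
    (h : ∃ k : ℤ, q * primeProd s = k) : ∃ k : ℤ, q * primeProd t = k := by
  obtain ⟨k, hk⟩ := h
  refine ⟨primeProd (t \ s) * k, ?_⟩
  rw [← primeProd_sdiff_mul hst]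
  push_cast
  rw [← hk]
  ring

/-- The group of the rationals whose denominator is a product of distinct `n`-th primes with
`f n = true`. -/
def primeGroup (f : ℕ → Bool) : AddSubgroup ℚ where
  carrier := {q | ∃ s, Supported f s ∧ ∃ k : ℤ, q * primeProd s = k}
  zero_mem' := ⟨∅, supported_empty f, 0, by simp⟩
  add_mem' := by
    rintro q r ⟨s, hs, hq⟩ ⟨t, ht, hr⟩
    obtain ⟨k, hk⟩ := mul_primeProd_mono (Finset.subset_union_left (s₂ := t)) hq
    obtain ⟨l, hl⟩ := mul_primeProd_mono (Finset.subset_union_right (s₁ := s)) hr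
    exact ⟨s ∪ t, hs.union ht, k + l, by rw [add_mul, hk, hl]; push_cast; rfl⟩
  neg_mem' := by
    rintro q ⟨s, hs, k, hk⟩
    exact ⟨s, hs, -k, by rw [neg_mul, hk]; push_cast; rfl⟩

theorem measurable_mem_primeGroup (q : ℚ) : Measurable fun f => q ∈ primeGroup f :=
  .exists fun s => (measurable_supported s).and measurable_const

theorem inv_primeProd_mem {f : ℕ → Bool} {s : Finset ℕ} (hs : Supported f s) :
    (primeProd s : ℚ)⁻¹ ∈ primeGroup f :=
  ⟨s, hs, 1, by simp [primeProd_ne_zero]⟩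

theorem one_mem_primeGroup (f : ℕ → Bool) : (1 : ℚ) ∈ primeGroup f :=
  ⟨∅, supported_empty f, 1, by simp [primeProd]⟩

theorem inv_prime_mem {f : ℕ → Bool} {n : ℕ} (hn : f n = true) :
    (Nat.nth Nat.Prime n : ℚ)⁻¹ ∈ primeGroup f :=
  ⟨{n}, by simpa [Supported] using hn, 1, by simp [primeProd, (prime_nth n).ne_zero]⟩

/-- Denominators are squarefree, so multiplying by the product of the primes indexed by `D` and
allowed by `f` removes exactly these primes. -/
theorem exists_mul_mem_primeGroup_iff_of_le {f h : ℕ → Bool} {D : Finset ℕ}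
    (hD : ∀ n, h n = if n ∈ D then false else f n) :
    ∃ r : ℚ, r ≠ 0 ∧ ∀ q, q ∈ primeGroup f ↔ r * q ∈ primeGroup h := by
  classical
  let T := D.filter fun n => f n = true
  have hT : Supported f T := fun n hn => (Finset.mem_filter.1 hn).2
  refine ⟨primeProd T, by exact_mod_cast primeProd_ne_zero T, fun q => ⟨?_, ?_⟩⟩
  · rintro ⟨s, hs, hk⟩
    obtain ⟨k, hk⟩ := mul_primeProd_mono (Finset.subset_union_left (s₂ := T)) hk
    refine ⟨(s ∪ T) \ T, fun n hn => ?_, k, ?_⟩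
    · rw [Finset.mem_sdiff] at hn
      have hfn := hs.union hT n hn.1
      rw [hD, if_neg fun hnD => hn.2 (Finset.mem_filter.2 ⟨hnD, hfn⟩), hfn]
    · rw [← hk, ← primeProd_sdiff_mul (Finset.subset_union_right (s₁ := s))]
      push_cast
      ring
  · rintro ⟨s, hs, k, hk⟩
    have hsD : ∀ n ∈ s, n ∉ D ∧ f n = true := fun n hn => by
      have h1 := hs n hn
      rw [hD] at h1
      split_ifs at h1 with h2
      exact ⟨h2, h1⟩
    refine ⟨s ∪ T, Supported.union (fun n hn => (hsD n hn).2) hT, k, ?_⟩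
    have hdisj : Disjoint s T := Finset.disjoint_left.2 fun n hn hnT =>
      (hsD n hn).1 (Finset.mem_filter.1 hnT).1
    have : primeProd (s ∪ T) = primeProd s * primeProd T := Finset.prod_union hdisj
    rw [← hk, this]
    push_cast
    ring

/-- Both groups are scaled to that of the common function obtained by zeroing the first `N` bits;
the scaling is the quotient of the two factors. -/
theorem E0.exists_mul_mem_primeGroup_iff {f g : ℕ → Bool} (h : E0 f g) :
    ∃ r : ℚ, r ≠ 0 ∧ ∀ q, q ∈ primeGroup f ↔ r * q ∈ primeGroup g := by
  obtain ⟨N, hN⟩ := Filter.eventually_atTop.1 h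
  obtain ⟨a, ha, hfa⟩ := exists_mul_mem_primeGroup_iff_of_le (f := f) (D := Finset.range N)
    fun n => rfl
  obtain ⟨b, hb, hgb⟩ := exists_mul_mem_primeGroup_iff_of_le (f := g) (D := Finset.range N)
    (h := fun n => if n ∈ Finset.range N then false else f n) fun n => by
      split_ifs with hn
      · rfl
      · exact hN n (by simpa using hn)
  refine ⟨a / b, div_ne_zero ha hb, fun q => ?_⟩
  rw [hfa, hgb]
  congr! 1
  field_simp

theorem E0.of_finite {f g : ℕ → Bool} (h₁ : {n | f n = true ∧ g n ≠ true}.Finite)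
    (h₂ : {n | g n = true ∧ f n ≠ true}.Finite) : E0 f g := by
  rw [E0, ← Nat.cofinite_eq_atTop, Filter.eventually_cofinite]
  refine (h₁.union h₂).subset fun n hn => ?_
  have hn : f n ≠ g n := hn
  simp only [Set.mem_union, Set.mem_ofPred_eq]
  revert hn
  cases f n <;> cases g n <;> simp

theorem finite_setOf_nth_prime_dvd {d : ℕ} (hd : d ≠ 0) :
    {n | Nat.nth Nat.Prime n ∣ d}.Finite :=
  Set.Finite.of_finite_image ((Set.finite_Iic d).subset (by
    rintro _ ⟨n, hn, rfl⟩
    exact Nat.le_of_dvd (Nat.pos_of_ne_zero hd) hn))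
    (Nat.nth_injective Nat.infinite_setOfPred_prime).injOn

/-- If `f n` is true, $1$ is divisible by $p_n$ in the source, so its image `u` is divisible by
$p_n$ in the target. If `g n` is false, no denominator there contains $p_n$, so $p_n$ divides the
numerator of `u`. -/
theorem primeGroup_finite_sdiff {f g : ℕ → Bool} (σ : primeGroup f →+ primeGroup g)
    (hσ : Function.Injective σ) : {n | f n = true ∧ g n ≠ true}.Finite := by
  let u : ℚ := σ ⟨1, one_mem_primeGroup f⟩
  have hu : u ≠ 0 := by
    have h : σ ⟨1, one_mem_primeGroup f⟩ ≠ 0 := by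
      rw [Ne, map_eq_zero_iff σ hσ]
      exact fun h => one_ne_zero (congrArg Subtype.val h)
    exact fun h' => h (Subtype.ext h')
  refine (finite_setOf_nth_prime_dvd (d := u.num.natAbs) (by simpa using hu)).subset ?_
  rintro n ⟨hf, hg⟩
  let v := σ ⟨_, inv_prime_mem hf⟩
  have huv : u = Nat.nth Nat.Prime n * (v : ℚ) := by
    have h : (⟨1, one_mem_primeGroup f⟩ : primeGroup f) =
        Nat.nth Nat.Prime n • ⟨_, inv_prime_mem hf⟩ := by
      ext
      simp [(prime_nth n).ne_zero]
    simp only [u, v, h, map_nsmul, AddSubgroup.coe_nsmul, nsmul_eq_mul]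
  obtain ⟨s, hs, k, hk⟩ := v.2
  have hns : ¬ Nat.nth Nat.Prime n ∣ primeProd s := fun h => hg (hs n (mem_of_dvd_primeProd h))
  have h1 : u.num * primeProd s = Nat.nth Nat.Prime n * (k * u.den) := by
    have h2 : (u.num : ℚ) = u * u.den := (Rat.mul_den_eq_num u).symm
    have h3 : (u.num * primeProd s : ℚ) = Nat.nth Nat.Prime n * (k * u.den) := by
      rw [h2, huv, ← hk]
      ring
    exact_mod_cast h3
  have h4 : Nat.nth Nat.Prime n ∣ u.num.natAbs * primeProd s := by
    have := congrArg Int.natAbs h1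
    rw [Int.natAbs_mul, Int.natAbs_mul, Int.natAbs_natCast, Int.natAbs_natCast] at this
    exact ⟨_, this⟩
  exact ((prime_nth n).dvd_mul.1 h4).resolve_right hns

theorem rank_primeGroup (f : ℕ → Bool) : Module.rank ℤ (primeGroup f) = 1 := by
  apply le_antisymm
  · refine (Submodule.rank_le (AddSubgroup.toIntSubmodule (primeGroup f))).trans ?_
    rw [← IsFractionRing.rank_right_eq ℤ ℚ]
    simp
  · rw [Cardinal.one_le_iff_ne_zero]
    intro h
    have := rank_zero_iff.1 h
    exact one_ne_zero (congrArg Subtype.val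
      (Subsingleton.elim (⟨1, one_mem_primeGroup f⟩ : primeGroup f) 0))

theorem borelReducible_E0_TFAb_one : BorelReducible E0 (isoOn (TFAb 1)) := by
  obtain ⟨Φ, hΦ, h⟩ := exists_measurable_groupCopy primeGroup
    (fun f => (Set.infinite_range_of_injective Int.cast_injective).mono (by
      rintro _ ⟨k, rfl⟩
      exact ⟨∅, supported_empty f, k, by simp [primeProd]⟩)) measurable_mem_primeGroup
  choose e he using h
  refine ⟨fun f => ⟨Φ f, primeGroup f, inferInstance, e f, he f, inferInstance,
    by simpa using rank_primeGroup f⟩, hΦ.subtype_mk, fun f g => ?_⟩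
  rw [isoOn, (he f).iso_iff (he g)]
  constructor
  · intro h
    obtain ⟨r, hr, hfg⟩ := h.exists_mul_mem_primeGroup_iff
    refine ⟨{ toFun := fun q => ⟨r * q, (hfg q).1 q.2⟩,
              invFun := fun q => ⟨r⁻¹ * q, (hfg _).2 (by rw [mul_inv_cancel_left₀ hr]; exact q.2)⟩,
              left_inv := fun q => by simp [hr],
              right_inv := fun q => by simp [hr],
              map_add' := fun q q' => by ext; simp [mul_add] }⟩
  · rintro ⟨σ⟩
    exact E0.of_finite (primeGroup_finite_sdiff σ.toAddMonoidHom σ.injective)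
      (primeGroup_finite_sdiff σ.symm.toAddMonoidHom σ.symm.injective)

open IntermediateField

/-! ### Degrees of simple transcendental extensions -/

section Simple

variable {k Ω : Type} [Field k] [Field Ω] [Algebra k Ω]

/-- The degree of $k(X)$ over $k(r)$, carried into `Ω` by the embedding $X \mapsto v$. -/
theorem relfinrank_adjoin_simple_eq {v : Ω} (hv : Transcendental k v) (r : RatFunc k) :
    (k⟮(RatFunc.algEquivOfTranscendental v hv r : Ω)⟯).relfinrank k⟮v⟯ =
      max r.num.natDegree r.denom.natDegree := by
  let φ : RatFunc k →ₐ[k] Ω := k⟮v⟯.val.comp (RatFunc.algEquivOfTranscendental v hv).toAlgHom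
  have hX : φ RatFunc.X = v := RatFunc.algEquivOfTranscendental_X v hv
  have hr : φ r = (RatFunc.algEquivOfTranscendental v hv r : Ω) := rfl
  have htop : k⟮v⟯ = (⊤ : IntermediateField k (RatFunc k)).map φ := by
    rw [← RatFunc.adjoin_X, adjoin_map, Set.image_singleton, hX]
  rw [← hr, ← RatFunc.finrank_eq_max_natDegree r, ← relfinrank_top_right, ← relfinrank_map_map _ _ φ,
    ← htop, adjoin_map, Set.image_singleton]

theorem relfinrank_adjoin_simple_pow {v : Ω} (hv : Transcendental k v) (n : ℕ) :
    (k⟮v ^ n⟯).relfinrank k⟮v⟯ = n := by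
  have h := relfinrank_adjoin_simple_eq hv (RatFunc.X ^ n)
  have hX : (RatFunc.algEquivOfTranscendental v hv (RatFunc.X ^ n) : Ω) = v ^ n := by
    rw [map_pow, SubmonoidClass.coe_pow, RatFunc.algEquivOfTranscendental_X]
  have hp : (RatFunc.X ^ n : RatFunc k) = algebraMap (Polynomial k) (RatFunc k) (Polynomial.X ^ n) := by
    rw [map_pow, RatFunc.algebraMap_X]
  rw [hX] at h
  rw [h, hp, RatFunc.num_algebraMap, RatFunc.denom_algebraMap]
  simp

/-- `relfinrank` is `0` for infinite degree. Here a zero would make numerator and denominator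
constant, putting `u` in `k`. -/
theorem relfinrank_adjoin_simple_ne_zero {u v : Ω} (hv : Transcendental k v)
    (hu : Transcendental k u) (huv : u ∈ k⟮v⟯) : (k⟮u⟯).relfinrank k⟮v⟯ ≠ 0 := by
  obtain ⟨r, hr⟩ := (RatFunc.algEquivOfTranscendental v hv).surjective ⟨u, huv⟩
  have h := relfinrank_adjoin_simple_eq hv r
  rw [hr] at h
  rw [h]
  intro h0
  have h1 : r.num.natDegree = 0 := by omega
  have h2 : r.denom.natDegree = 0 := by omega
  obtain ⟨a, ha⟩ := Polynomial.natDegree_eq_zero.1 h1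
  obtain ⟨b, hb⟩ := Polynomial.natDegree_eq_zero.1 h2
  refine hu ?_
  have h3 : u = algebraMap k Ω (a / b) := by
    have h4 := RatFunc.algEquivOfTranscendental_apply v hv r
    rw [hr, ← ha, ← hb] at h4
    simpa using h4
  rw [h3]
  exact isAlgebraic_algebraMap _

theorem trdeg_adjoin_simple {v : Ω} (hv : Transcendental k v) :
    Algebra.trdeg k k⟮v⟯ = 1 := by
  rw [← (RatFunc.algEquivOfTranscendental v hv).trdeg_eq]
  have : Algebra.IsAlgebraic (Polynomial k) (RatFunc k) :=
    IsLocalization.isAlgebraic _ (nonZeroDivisors (Polynomial k))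
  rw [← trdeg_add_eq k (Polynomial k) (A := RatFunc k), Polynomial.trdeg_of_isDomain,
    trdeg_eq_zero, add_zero]

theorem trdeg_eq_one_of_isAlgebraic {v : Ω} (hv : Transcendental k v) (E : IntermediateField k Ω)
    (hvE : v ∈ E) (hE : ∀ y ∈ E, IsAlgebraic k⟮v⟯ y) : Algebra.trdeg k E = 1 := by
  have hle : k⟮v⟯ ≤ E := adjoin_simple_le_iff.2 hvE
  let E' := extendScalars hle
  have : Algebra.IsAlgebraic k⟮v⟯ E' := ⟨fun y =>
    (isAlgebraic_algHom_iff E'.val Subtype.val_injective).1 (hE y y.2)⟩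
  have : FaithfulSMul k⟮v⟯ E' :=
    (faithfulSMul_iff_algebraMap_injective _ _).2 (algebraMap k⟮v⟯ E').injective
  have h : Algebra.trdeg k E' = 1 := by
    rw [← trdeg_add_eq k k⟮v⟯ (A := E'), trdeg_adjoin_simple hv, trdeg_eq_zero, add_zero]
  exact h

end Simple

/-! ### Fields with rational powers of a transcendental element -/

/-- Compatible rational powers `t ^ q` of a transcendental element `t` of `Ω`, such that
`t ^ q ↦ t ^ (r * q)` extends to an automorphism of `Ω` for all `r ≠ 0`. -/
structure RationalPowers (k Ω : Type) [Field k] [Field Ω] [Algebra k Ω] where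
  /-- The element `t ^ q`. -/
  pow : ℚ → Ω
  pow_zero : pow 0 = 1
  pow_add : ∀ q r, pow (q + r) = pow q * pow r
  transcendental_one : Transcendental k (pow 1)
  exists_scale : ∀ r : ℚ, r ≠ 0 → ∃ σ : Ω ≃ₐ[k] Ω, ∀ q, σ (pow q) = pow (r * q)

namespace RationalPowers

variable {k Ω : Type} [Field k] [Field Ω] [Algebra k Ω] (T : RationalPowers k Ω)

theorem pow_mul_neg (q : ℚ) : T.pow q * T.pow (-q) = 1 := by
  rw [← T.pow_add, add_neg_cancel, T.pow_zero]

theorem pow_neg (q : ℚ) : T.pow (-q) = (T.pow q)⁻¹ :=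
  (inv_eq_of_mul_eq_one_right (T.pow_mul_neg q)).symm

theorem pow_natCast_mul (n : ℕ) (q : ℚ) : T.pow (n * q) = T.pow q ^ n := by
  induction n with
  | zero => simp [T.pow_zero]
  | succ n ih => rw [Nat.cast_succ, add_mul, one_mul, T.pow_add, ih, pow_succ]

theorem pow_intCast_mul (n : ℤ) (q : ℚ) : T.pow (n * q) = T.pow q ^ n := by
  cases n with
  | ofNat n => simpa using T.pow_natCast_mul n q
  | negSucc n =>
    rw [Int.cast_negSucc, neg_mul, T.pow_neg, T.pow_natCast_mul, zpow_negSucc]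

/-- An automorphism over `k` carries `pow 1` to `pow q`. -/
theorem transcendental {q : ℚ} (hq : q ≠ 0) : Transcendental k (T.pow q) := by
  obtain ⟨σ, hσ⟩ := T.exists_scale q hq
  have h := hσ 1
  rw [mul_one] at h
  rw [← h]
  exact fun h' => T.transcendental_one ((isAlgebraic_algHom_iff σ.toAlgHom σ.injective).1 h')

/-- The simple extension generated by `t ^ (1 / m)`, `m` the product of the primes in `s`. -/
noncomputable def simple (s : Finset ℕ) : IntermediateField k Ω :=
  k⟮T.pow (primeProd s : ℚ)⁻¹⟯

theorem pow_mem_simple {q : ℚ} {s : Finset ℕ} (h : ∃ l : ℤ, q * primeProd s = l) :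
    T.pow q ∈ T.simple s := by
  obtain ⟨l, hl⟩ := h
  have h0 : (primeProd s : ℚ) ≠ 0 := by exact_mod_cast primeProd_ne_zero s
  have hq : q = l * (primeProd s : ℚ)⁻¹ := by rw [← hl, mul_inv_cancel_right₀ h0]
  rw [hq, T.pow_intCast_mul]
  exact zpow_mem (mem_adjoin_simple_self k _) l

theorem simple_mono {s t : Finset ℕ} (h : s ⊆ t) : T.simple s ≤ T.simple t :=
  adjoin_simple_le_iff.2 <| T.pow_mem_simple <| mul_primeProd_mono h
    ⟨1, by simp [primeProd_ne_zero]⟩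

theorem transcendental_inv_primeProd (s : Finset ℕ) :
    Transcendental k (T.pow (primeProd s : ℚ)⁻¹) :=
  T.transcendental (inv_ne_zero (by exact_mod_cast primeProd_ne_zero s))

theorem relfinrank_simple {s t : Finset ℕ} (h : s ⊆ t) :
    (T.simple s).relfinrank (T.simple t) = primeProd (t \ s) := by
  have h1 : T.pow (primeProd s : ℚ)⁻¹ = T.pow (primeProd t : ℚ)⁻¹ ^ primeProd (t \ s) := by
    rw [← T.pow_natCast_mul, ← primeProd_sdiff_mul h]
    congr 1
    have h2 : (primeProd (t \ s) : ℚ) ≠ 0 := by exact_mod_cast primeProd_ne_zero _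
    push_cast
    field_simp
  rw [simple, simple, h1]
  exact relfinrank_adjoin_simple_pow (T.transcendental_inv_primeProd t) _

/-- The field generated by the `t ^ q` with `q` in the group attached to `f`. -/
noncomputable def field (f : ℕ → Bool) : IntermediateField k Ω :=
  ⨆ s : {s // Supported f s}, T.simple s

/-- The simple extensions are directed under union of index sets, so their supremum is a plain
union; this also makes membership measurable in `f`. -/
theorem mem_field {f : ℕ → Bool} {x : Ω} :
    x ∈ T.field f ↔ ∃ s, Supported f s ∧ x ∈ T.simple s := by
  have : Nonempty {s // Supported f s} := ⟨⟨∅, supported_empty f⟩⟩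
  rw [← SetLike.mem_coe, field, coe_iSup_of_directed]
  · simp
  · exact fun s t => ⟨⟨s ∪ t, s.2.union t.2⟩, T.simple_mono Finset.subset_union_left,
      T.simple_mono Finset.subset_union_right⟩

theorem measurable_mem_field (x : Ω) : Measurable fun f => x ∈ T.field f := by
  simp_rw [mem_field]
  exact .exists fun s => (measurable_supported s).and measurable_const

theorem pow_mem_field {f : ℕ → Bool} {q : ℚ} (hq : q ∈ primeGroup f) : T.pow q ∈ T.field f := by
  obtain ⟨s, hs, hl⟩ := hq
  exact T.mem_field.2 ⟨s, hs, T.pow_mem_simple hl⟩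

theorem map_field_le {f g : ℕ → Bool} {r : ℚ} (σ : Ω →ₐ[k] Ω) (hσ : ∀ q, σ (T.pow q) = T.pow (r * q))
    (h : ∀ q ∈ primeGroup f, r * q ∈ primeGroup g) : (T.field f).map σ ≤ T.field g := by
  rw [map_le_iff_le_comap, field, iSup_le_iff]
  rintro ⟨s, hs⟩
  refine adjoin_simple_le_iff.2 ?_
  change σ (T.pow (primeProd s : ℚ)⁻¹) ∈ T.field g
  rw [hσ]
  exact T.pow_mem_field (h _ (inv_primeProd_mem hs))

theorem nonempty_ringEquiv_field {f g : ℕ → Bool} (h : E0 f g) :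
    Nonempty (T.field f ≃+* T.field g) := by
  obtain ⟨r, hr, hfg⟩ := h.exists_mul_mem_primeGroup_iff
  obtain ⟨σ, hσ⟩ := T.exists_scale r hr
  have hσ' : ∀ q, σ.symm (T.pow q) = T.pow (r⁻¹ * q) := fun q => by
    rw [AlgEquiv.symm_apply_eq, hσ, mul_inv_cancel_left₀ hr]
  have h1 := T.map_field_le (σ : Ω →ₐ[k] Ω) hσ fun q => (hfg q).1
  have h2 := T.map_field_le (σ.symm : Ω →ₐ[k] Ω) hσ' fun q hq =>
    (hfg _).2 (by rwa [mul_inv_cancel_left₀ hr])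
  have h3 : (T.field f).map (σ : Ω →ₐ[k] Ω) = T.field g := by
    refine h1.antisymm fun x hx => ?_
    exact ⟨σ.symm x, h2 ⟨x, hx, rfl⟩, σ.apply_symm_apply x⟩
  exact ⟨((intermediateFieldMap σ (T.field f)).trans (equivOfEq h3)).toRingEquiv⟩

/-- The image of $t$ lies in some `T.simple s₀`, of finite degree `d` over the field it generates.
If `f n` is true, $t$ is a $p_n$-th power, which puts a factor $p_n$ into a degree in the target. If
`g n` is false, enlarging `s₀` contributes no such factor, so $p_n$ divides `d`. -/
theorem finite_sdiff {f g : ℕ → Bool} (σ : T.field f →ₐ[k] T.field g) :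
    {n | f n = true ∧ g n ≠ true}.Finite := by
  let τ : T.field f →ₐ[k] Ω := (T.field g).val.comp σ
  let x : T.field f := ⟨T.pow 1, T.pow_mem_field (one_mem_primeGroup f)⟩
  have htr : Transcendental k (τ x) := fun h => T.transcendental_one
    ((isAlgebraic_algHom_iff (T.field f).val Subtype.val_injective).2
      ((isAlgebraic_algHom_iff τ τ.injective).1 h))
  obtain ⟨s₀, hs₀, hx⟩ := T.mem_field.1 (σ x).2
  let d := (k⟮τ x⟯).relfinrank (T.simple s₀)
  have hd : d ≠ 0 := relfinrank_adjoin_simple_ne_zero (T.transcendental_inv_primeProd s₀) htr hx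
  refine (finite_setOf_nth_prime_dvd hd).subset ?_
  rintro n ⟨hf, hg⟩
  let y : T.field f := ⟨_, T.pow_mem_field (inv_prime_mem hf)⟩
  have hxy : x = y ^ Nat.nth Nat.Prime n := by
    ext
    simp only [x, y, SubmonoidClass.mk_pow, ← T.pow_natCast_mul]
    rw [mul_inv_cancel₀ (by exact_mod_cast (prime_nth n).ne_zero)]
  have hτ : τ x = τ y ^ Nat.nth Nat.Prime n := by rw [hxy, map_pow]
  have hytr : Transcendental k (τ y) := fun h => htr (hτ ▸ h.pow _)
  obtain ⟨s₁, hs₁, hy⟩ := T.mem_field.1 (σ y).2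
  have h₀ : T.simple s₀ ≤ T.simple (s₀ ∪ s₁) := T.simple_mono Finset.subset_union_left
  have h₁ : T.simple s₁ ≤ T.simple (s₀ ∪ s₁) := T.simple_mono Finset.subset_union_right
  have hle₀ : k⟮τ x⟯ ≤ T.simple s₀ := adjoin_simple_le_iff.2 hx
  have hle₁ : k⟮τ y⟯ ≤ T.simple (s₀ ∪ s₁) := adjoin_simple_le_iff.2 (h₁ hy)
  have hle : k⟮τ x⟯ ≤ k⟮τ y⟯ :=
    adjoin_simple_le_iff.2 (hτ ▸ pow_mem (mem_adjoin_simple_self k _) _)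
  -- The degree of `T.simple (s₀ ∪ s₁)` over $k(\tau x)$ is computed through $k(\tau y)$ and through
  -- `T.simple s₀`.
  have hmul := (relfinrank_mul_relfinrank hle hle₁).trans (relfinrank_mul_relfinrank hle₀ h₀).symm
  rw [T.relfinrank_simple Finset.subset_union_left] at hmul
  have hdeg : (k⟮τ x⟯).relfinrank k⟮τ y⟯ = Nat.nth Nat.Prime n := by
    rw [hτ]
    exact relfinrank_adjoin_simple_pow hytr _
  rw [hdeg] at hmul
  refine ((prime_nth n).dvd_mul.1 ⟨_, hmul.symm⟩).resolve_right fun h => hg ?_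
  exact (hs₀.union hs₁) n (Finset.mem_sdiff.1 (mem_of_dvd_primeProd h)).1

theorem trdeg_field (f : ℕ → Bool) : Algebra.trdeg k (T.field f) = 1 := by
  refine trdeg_eq_one_of_isAlgebraic T.transcendental_one _
    (T.pow_mem_field (one_mem_primeGroup f)) ?_
  have hle : T.field f ≤ (algebraicClosure k⟮T.pow 1⟯ Ω).restrictScalars k := by
    rw [field, iSup_le_iff]
    rintro ⟨s, _⟩
    refine adjoin_simple_le_iff.2 ?_
    rw [mem_restrictScalars, mem_algebraicClosure_iff]
    refine IsAlgebraic.of_pow (Nat.pos_of_ne_zero (primeProd_ne_zero s)) ?_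
    rw [← T.pow_natCast_mul, mul_inv_cancel₀ (by exact_mod_cast primeProd_ne_zero s)]
    exact isAlgebraic_algebraMap (⟨T.pow 1, mem_adjoin_simple_self k _⟩ : k⟮T.pow 1⟯)
  exact fun y hy => mem_algebraicClosure_iff.1 (hle hy)

end RationalPowers

/-! ### An ambient field with rational powers -/

theorem transcendental_single_one (k : Type) [Field k] :
    Transcendental k (AddMonoidAlgebra.single (1 : ℚ) (1 : k)) := by
  rw [transcendental_iff]
  intro p hp
  ext n
  rw [Polynomial.coeff_zero]
  by_cases hn : p.natDegree < n
  · exact Polynomial.coeff_eq_zero_of_natDegree_lt hn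
  have h := congrArg (fun a => a.coeff (n : ℚ)) hp
  simp only [Polynomial.aeval_eq_sum_range, AddMonoidAlgebra.single_pow,
    AddMonoidAlgebra.smul_single] at h
  simpa [AddMonoidAlgebra.coeff_sum, Finsupp.finsetSum_apply, Finsupp.single_apply,
    not_lt.1 hn] using h

/-- `Ω` is the fraction field of the group algebra of $\mathbb{Q}$ over `k`; multiplication by `r`
is an automorphism of the exponent group and extends to `Ω`. -/
theorem exists_rationalPowers (k : Type) [Field k] [Countable k] :
    ∃ (Ω : Type) (_ : Field Ω) (_ : Algebra k Ω) (_ : Countable Ω),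
      Nonempty (RationalPowers k Ω) := by
  let A := AddMonoidAlgebra k ℚ
  let Ω := FractionRing A
  have : Countable A := AddMonoidAlgebra.coeffEquiv.injective.countable
  have : Countable Ω := (IsLocalization.mk'_surjective (nonZeroDivisors A) (S := Ω)).countable
  refine ⟨Ω, inferInstance, inferInstance, inferInstance,
    ⟨{ pow := fun q => algebraMap A Ω (AddMonoidAlgebra.single q 1)
       pow_zero := map_one _
       pow_add := fun q r => ?_
       transcendental_one := ?_
       exists_scale := fun r hr => ?_ }⟩⟩
  · rw [← map_mul, AddMonoidAlgebra.single_mul_single, one_mul]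
  · exact (transcendental_algebraMap_iff (IsFractionRing.injective A Ω)).2
      (transcendental_single_one k)
  · refine ⟨IsFractionRing.algEquivOfAlgEquiv
      (AddMonoidAlgebra.domCongr k k (LinearEquiv.smulOfNeZero ℚ ℚ r hr).toAddEquiv), fun q => ?_⟩
    rw [IsFractionRing.algEquivOfAlgEquiv_algebraMap, AddMonoidAlgebra.domCongr_single]
    rfl

theorem borelReducible_E0_FD_one : BorelReducible E0 (isoOn (FD 1)) := by
  obtain ⟨Ω, _, _, _, ⟨T⟩⟩ := exists_rationalPowers ℚ
  have hchar : ∀ f, CharZero (T.field f) := fun f =>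
    charZero_of_injective_algebraMap (algebraMap ℚ (T.field f)).injective
  have hinf : ∀ f, (T.field f : Set Ω).Infinite := fun f =>
    Set.infinite_coe_iff.1 (inferInstance : Infinite (T.field f))
  obtain ⟨Φ, hΦ, h⟩ := exists_measurable_fieldCopy T.field hinf T.measurable_mem_field
  choose e he using h
  -- `FD` uses the canonical `ℚ`-algebra structure, `trdeg_field` that of an intermediate field; a
  -- ring carries at most one.
  have htr : ∀ f, @Algebra.trdeg ℚ (T.field f) _ _ DivisionRing.toRatAlgebra = 1 := fun f => by
    rw [← T.trdeg_field f]
    congr 1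
    exact Subsingleton.elim _ _
  refine ⟨fun f => ⟨Φ f, T.field f, inferInstance, hchar f, e f, he f, by simpa using htr f⟩,
    hΦ.subtype_mk, fun f g => ?_⟩
  rw [isoOn, (he f).iso_iff (he g)]
  constructor
  · exact T.nonempty_ringEquiv_field
  · rintro ⟨σ⟩
    -- Over the prime field `ℚ` every ring homomorphism is an algebra homomorphism, so no base field
    -- has to be preserved by assumption.
    exact E0.of_finite
      (T.finite_sdiff <| @RingHom.toRatAlgHom _ _ _ _ (T.field f).algebra' (T.field g).algebra'
        (σ : T.field f →+* T.field g))
      (T.finite_sdiff <| @RingHom.toRatAlgHom _ _ _ _ (T.field g).algebra' (T.field f).algebra'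
        (σ.symm : T.field g →+* T.field f))

/-! ### Composition of reductions and the final assembly -/

theorem BorelReducible.trans {X Y Z : Type} [MeasurableSpace X] [MeasurableSpace Y]
    [MeasurableSpace Z] {E : X → X → Prop} {F : Y → Y → Prop} {G : Z → Z → Prop}
    (h₁ : BorelReducible E F) (h₂ : BorelReducible F G) : BorelReducible E G := by
  obtain ⟨Φ, hΦ, h₁⟩ := h₁
  obtain ⟨Ψ, hΨ, h₂⟩ := h₂
  exact ⟨Ψ ∘ Φ, hΨ.comp hΦ, fun x y => (h₁ x y).trans (h₂ _ _)⟩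

end FieldClasses

theorem mainTheorem7 :
    -- there is no Borel embedding of `FD_1` in `FD_0`
    ¬ FieldClasses.BorelEmbeddable (FieldClasses.FD 1) (FieldClasses.FD 0) ∧
    -- isomorphism on `FD_0` is smooth
    FieldClasses.Smooth (FieldClasses.isoOn (FieldClasses.FD 0)) ∧
    -- via existential theories
    (Measurable (fun A : FieldClasses.FD 0 => FieldClasses.existentialTheory A.1) ∧
      ∀ A B : FieldClasses.FD 0, FieldClasses.isoOn (FieldClasses.FD 0) A B ↔
        FieldClasses.existentialTheory A.1 = FieldClasses.existentialTheory B.1) ∧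
    -- in fact via the sentences saying which integer polynomials have roots
    (Measurable (fun A : FieldClasses.FD 0 => FieldClasses.rootSet A.1) ∧
      ∀ A B : FieldClasses.FD 0, FieldClasses.isoOn (FieldClasses.FD 0) A B ↔
        FieldClasses.rootSet A.1 = FieldClasses.rootSet B.1) ∧
    -- `E_0` is Borel reducible to isomorphism on `TFAb_1`, and on `FD_1`
    FieldClasses.BorelReducible FieldClasses.E0 (FieldClasses.isoOn (FieldClasses.TFAb 1)) ∧
    FieldClasses.BorelReducible FieldClasses.E0 (FieldClasses.isoOn (FieldClasses.FD 1)) ∧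
    -- `E_0` is not smooth
    ¬ FieldClasses.Smooth FieldClasses.E0 := by
  open FieldClasses in
  exact ⟨fun h => not_smooth_E0 ((borelReducible_E0_FD_one.trans h).trans smooth_isoOn_FD_zero),
    smooth_isoOn_FD_zero,
    ⟨measurable_existentialTheory (FD 0), isoOn_FD_zero_iff_existentialTheory⟩,
    ⟨measurable_rootSet, isoOn_FD_zero_iff_rootSet⟩,
    borelReducible_E0_TFAb_one, borelReducible_E0_FD_one, not_smooth_E0⟩
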